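/- Rings are associative, not necessarily unital. For a ring $R$ let $J(R)=\{x\in R:\forall y\,\exists z\;(yx+z+zyx=0)\}$ be its Jacobson radical; a subset $S\subseteq R$ is nilpotent if for some $m\ge 1$ all products $s_1\cdots s_m$ with $s_i\in S$ are $0$. A small profinite ring is a compact Hausdorff topological ring $R$ together with a distinguished countable basis of neighbourhoods of $0$ consisting of open (two-sided) ideals (equivalently, a presentation of $R$ as the limit of a countable inverse system of finite rings), and with a closed subgroup $\mathrm{Aut}^*(R)$ (for the topology of pointwise convergence) of the group of all ring automorphisms of $R$ fixing setwise each of these ideals, such that for every $n<\omega$ the group $\mathrm{Aut}^*(R)$ has only countably many orbits on $R^n$. For a prime $p$, let $F_0$ be the free commutative nil ring of nilexponent $p$ and characteristic $p$ on generators $(x_i)_{i<\omega}$, i.e. the quotient of the non-unital ring of polynomials over $\mathbb{F}_p$ in the variables $x_i$ with zero constant term by the ideal generated by the $p$-th powers of all its elements. For $n<\omega$ let $I_n$ be the ideal of $F_0$ generated by $\{x_i:i\ge n\}$, and let $F=F_{(p)}=\varprojlim_n F_0/I_n$, the inverse limit of the discrete rings $F_0/I_n$, as a topological ring. Corollary.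 Suppose that the conjecture "the Jacobson radical of every small profinite ring is nilpotent" fails in the class of commutative rings, i.e. there is a commutative small profinite ring whose Jacobson radical is not nilpotent. Then there are a commutative small profinite ring $R$ whose Jacobson radical is not nilpotent and a prime $p$ such that $F_{(p)}$ is topologically isomorphic (as a topological ring) to a closed subring of $R$. -/

import Mathlib

universe u

noncomputable section

namespace SmallProfinite

/-! ### Nilpotency and the Jacobson radical in rings without identity -/

/-- The product `r 0 * r 1 * ⋯ * r n` of `n + 1` elements of a ring, possibly without identity. -/
def prodUpTo {R : Type*} [Mul R] (r : ℕ → R) : ℕ → R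
  | 0 => r 0
  | n + 1 => prodUpTo r n * r (n + 1)

/-- A subset `S` (in practice an ideal) of a ring is nilpotent if, for some `m ≥ 1`,
all products of `m` elements of `S` vanish; here `m = n + 1`. -/
def IsNilpotentSet {R : Type*} [NonUnitalRing R] (S : Set R) : Prop :=
  ∃ n : ℕ, ∀ r : ℕ → R, (∀ i, r i ∈ S) → prodUpTo r n = 0

/-- The Jacobson radical of a ring, possibly without identity: the set of all `x` such that
every element of `R x` is left quasi-regular. -/
def jacobsonRadical (R : Type*) [NonUnitalRing R] : Set R :=
  {x | ∀ y : R, ∃ z : R, y * x + z + z * y * x = 0}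

/-! ### Small profinite rings -/

/-- The standard structural group of a ring with a distinguished family `B` of ideals: the
ring automorphisms fixing setwise every ideal of `B`. -/
def standardAut {R : Type*} [NonUnitalRing R] (B : Set (TwoSidedIdeal R)) :
    Subgroup (RingAut R) where
  carrier := {g | ∀ I ∈ B, ∀ x : R, g x ∈ I ↔ x ∈ I}
  mul_mem' := by
    intro f g hf hg I hI x
    exact (hf I hI (g x)).trans (hg I hI x)
  one_mem' := fun _ _ _ => Iff.rfl
  inv_mem' := by
    intro f hf I hI x
    have h := hf I hI (f⁻¹ x)
    have e : f (f⁻¹ x) = x := f.apply_symm_apply x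
    rw [e] at h
    exact h.symm

/-- The topology of pointwise convergence on the standard structural group. When `B` is a basis of
neighbourhoods of `0` this is also the topology of uniform convergence, because the elements of
the group preserve the members of `B`. -/
@[reducible] def standardAutTopology {R : Type*} [NonUnitalRing R] [TopologicalSpace R]
    (B : Set (TwoSidedIdeal R)) : TopologicalSpace (standardAut B) :=
  TopologicalSpace.induced (fun (g : standardAut B) (x : R) => (g : RingAut R) x)
    Pi.topologicalSpace

/-- A structure of small profinite ring on a compact Hausdorff topological ring `R`:
a distinguished countable basis of neighbourhoods of `0` consisting of open ideals (equivalently,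
a presentation of `R` as the limit of a countable inverse system of finite rings), and
a structural group, that is, a closed subgroup of the group of automorphisms fixing these ideals
setwise, having only countably many orbits on `n`-tuples for every `n`. -/
structure SmallProfiniteStructure (R : Type*) [NonUnitalRing R] [TopologicalSpace R]
    [IsTopologicalRing R] [CompactSpace R] [T2Space R] where
  basis : Set (TwoSidedIdeal R)
  basis_countable : basis.Countable
  basis_isOpen : ∀ I ∈ basis, IsOpen (I : Set R)
  basis_hasBasis : (nhds (0 : R)).HasBasis (fun I : TwoSidedIdeal R => I ∈ basis)
    (fun I => (I : Set R))
  structuralGroup : Subgroup (RingAut R)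
  structuralGroup_le : structuralGroup ≤ standardAut basis
  structuralGroup_closed :
    @IsClosed _ (standardAutTopology basis)
      {g : standardAut basis | (g : RingAut R) ∈ structuralGroup}
  countable_orbits : ∀ n : ℕ,
    (Set.range fun a : Fin n → R =>
      {b : Fin n → R | ∃ g ∈ structuralGroup, ∀ i, b i = g (a i)}).Countable

/-- The conjecture, for commutative rings, that the Jacobson radical of every small profinite
ring is nilpotent. -/
def CommNilpotentRadicalConjecture : Prop :=
  ∀ (R : Type u) [NonUnitalCommRing R] [TopologicalSpace R] [IsTopologicalRing R]
    [CompactSpace R] [T2Space R], SmallProfiniteStructure R →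
    IsNilpotentSet (jacobsonRadical R)

/-! ### The free commutative profinite nil ring of nilexponent and characteristic `p` -/

/-- The polynomials over `𝔽_p` in `x_0, x_1, …` without constant term. As a ring without identity,
this is the free commutative ring of characteristic `p` on the generators `x_i`. -/
abbrev PolyNoConst (p : ℕ) : Type :=
  RingHom.ker (MvPolynomial.constantCoeff : MvPolynomial ℕ (ZMod p) →+* ZMod p)

/-- The ideal generated by the `p`-th powers of all elements. -/
def powerIdeal (p : ℕ) : TwoSidedIdeal (PolyNoConst p) :=
  TwoSidedIdeal.span
    {f | ∃ g : PolyNoConst p, (f : MvPolynomial ℕ (ZMod p)) = (g : MvPolynomial ℕ (ZMod p)) ^ p}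

/-- The free commutative nil ring `F_0` of nilexponent `p` and characteristic `p` on the generators
`x_i`, `i < ω`: the quotient of the free commutative ring of characteristic `p` by the ideal
generated by all `p`-th powers. -/
abbrev FreeNil (p : ℕ) : Type := (powerIdeal p).ringCon.Quotient

/-- The generator `x_i` of `F_0`. -/
def FreeNil.x (p : ℕ) (i : ℕ) : FreeNil p :=
  ((⟨MvPolynomial.X i, by simp [RingHom.mem_ker]⟩ : PolyNoConst p) :
    (powerIdeal p).ringCon.Quotient)

/-- The ideal `I_n` of `F_0` generated by `x_i`, `i ≥ n`. -/
def tailIdeal (p n : ℕ) : TwoSidedIdeal (FreeNil p) :=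
  TwoSidedIdeal.span {a | ∃ i, n ≤ i ∧ a = FreeNil.x p i}

/-- The quotient ring `F_0 / I_n`, with the discrete topology. -/
def FreeNilQuot (p n : ℕ) : Type := (tailIdeal p n).ringCon.Quotient

instance (p n : ℕ) : NonUnitalCommRing (FreeNilQuot p n) :=
  inferInstanceAs (NonUnitalCommRing (tailIdeal p n).ringCon.Quotient)

instance (p n : ℕ) : TopologicalSpace (FreeNilQuot p n) := ⊥

instance (p n : ℕ) : DiscreteTopology (FreeNilQuot p n) := ⟨rfl⟩

theorem tailIdeal_anti (p : ℕ) {m n : ℕ} (h : m ≤ n) : tailIdeal p n ≤ tailIdeal p m :=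
  TwoSidedIdeal.span_mono fun _ ⟨i, hi, e⟩ => ⟨i, h.trans hi, e⟩

/-- The canonical map `F_0 / I_n → F_0 / I_m` for `m ≤ n`. -/
def FreeNilQuot.transition (p : ℕ) {m n : ℕ} (h : m ≤ n) :
    FreeNilQuot p n →ₙ+* FreeNilQuot p m where
  toFun := Quotient.map' id fun _ _ hab =>
    TwoSidedIdeal.ringCon_le_iff.mp (tailIdeal_anti p h) hab
  map_zero' := rfl
  map_add' := by rintro ⟨a⟩ ⟨b⟩; rfl
  map_mul' := by rintro ⟨a⟩ ⟨b⟩; rfl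

/-- The topological ring `F`, the inverse limit of the finite discrete rings `F_0 / I_n`, realised as
a subring of their product (and so carrying the subspace topology of the product topology). -/
def FreeProfiniteNil (p : ℕ) : NonUnitalSubring (∀ n, FreeNilQuot p n) where
  carrier := {f | ∀ (m n : ℕ) (h : m ≤ n), FreeNilQuot.transition p h (f n) = f m}
  zero_mem' := fun _ _ _ => map_zero _
  add_mem' := by
    intro f g hf hg m n h
    simp only [Pi.add_apply, map_add, hf m n h, hg m n h]
  neg_mem' := by
    intro f hf m n h
    simp only [Pi.neg_apply, map_neg, hf m n h]
  mul_mem' := by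
    intro f g hf hg m n h
    simp only [Pi.mul_apply, map_mul, hf m n h, hg m n h]

end SmallProfinite

end

/-!
Smallness makes the definable closure of every element countable, hence, being compact, finite. So
`R` has finite additive exponent and the elements of its radical are nilpotent. If the radicals of
all `R / pR`, `p` prime, were nilpotent, so would be that of `R`; thus some `R / pR`, again small,
has a radical that is not nilpotent. Adjoining an identity to it gives a compact ring `A` of
characteristic `p` whose nilradical is closed and not nilpotent.

The kernels of the iterated Frobenius maps are closed and exhaust the nilradical, so by Baire
category one of them already contains it. Hence for some `j` the kernel `K` of the Frobenius map on
the subring of `p ^ j`-th powers of `A` is not nilpotent. Suppose that `u` annihilates no power of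
`K` but `u * a ^ (p - 1)` annihilates one for every `a ∈ K` near `0`. By Baire category and
polarization, where `(p - 1)!` is a unit, `u` would annihilate a power of `K` too. So there are
`a₀, a₁, … ∈ K` such that `(a₀ ⋯ aₙ₋₁) ^ (p - 1)` lies outside an open ideal `Vₙ` containing all
`aᵢ` with `i ≥ n`, where the `Vₙ` form a basis of neighbourhoods of `0`. Since `F₀` is spanned by
the monomials with all exponents less than `p`, the homomorphism `xᵢ ↦ aᵢ` pulls `Vₙ` back to `Iₙ`,
and hence extends to a closed embedding of `F`.
-/

noncomputable section

namespace SmallProfinite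

/-! ### Baire category in compact groups -/

section CompactGroup

variable {X : Type*} [TopologicalSpace X] [CompactSpace X]

theorem exists_eq_top_of_monotone_of_isClosed [AddGroup X] [IsTopologicalAddGroup X]
    {H : ℕ → AddSubgroup X} (hmono : Monotone H) (hclosed : ∀ n, IsClosed (H n : Set X))
    (hcover : ∀ x, ∃ n, x ∈ H n) : ∃ n, H n = ⊤ := by
  obtain ⟨n, x, hx⟩ := nonempty_interior_of_iUnion_of_closed hclosed
    (Set.eq_univ_of_forall fun x => Set.mem_iUnion.2 (hcover x))
  have hopen (m : ℕ) : IsOpen (H (max n m) : Set X) :=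
    AddSubgroup.isOpen_mono (hmono (le_max_left n m))
      ((H n).isOpen_of_mem_nhds (mem_interior_iff_mem_nhds.1 hx))
  obtain ⟨m, hm⟩ := isCompact_univ.elim_directed_cover (fun m => (H (max n m) : Set X)) hopen
    (fun x _ => Set.mem_iUnion.2 <| (hcover x).imp fun m hm => hmono (le_max_right n m) hm)
    (Monotone.directed_le fun _ _ h => hmono (max_le_max le_rfl h))
  exact ⟨max n m, (AddSubgroup.eq_top_iff' _).2 fun x => hm (Set.mem_univ x)⟩

theorem finite_of_countable_of_compactSpace [T2Space X] [AddGroup X] [IsTopologicalAddGroup X]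
    [Countable X] : Finite X := by
  obtain ⟨x, y, hy⟩ := nonempty_interior_of_iUnion_of_closed (f := fun x : X => ({x} : Set X))
    (fun x => isClosed_singleton) (Set.iUnion_of_singleton X)
  have hyx : y = x := interior_subset (s := {x}) hy
  have hbot : ((⊥ : AddSubgroup X) : Set X) ∈ nhds 0 := by
    have h := (continuous_const_add x).continuousAt.preimage_mem_nhds (x := 0)
      (t := {x}) (by simpa [← hyx] using mem_interior_iff_mem_nhds.1 hy)
    convert h using 1
    ext z
    simp
  have : DiscreteTopology X :=
    discreteTopology_of_isOpen_singleton_zero (AddSubgroup.isOpen_of_mem_nhds ⊥ hbot)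
  exact finite_of_compact_of_discrete

theorem exponentExists_of_forall_isOfFinAddOrder [T2Space X] [AddCommGroup X]
    [IsTopologicalAddGroup X] (h : ∀ x : X, IsOfFinAddOrder x) : AddMonoid.ExponentExists X := by
  let H (n : ℕ) : AddSubgroup X := (nsmulAddMonoidHom n.factorial).ker
  obtain ⟨n, hn⟩ : ∃ n, H n = ⊤ := by
    refine exists_eq_top_of_monotone_of_isClosed (fun m n hmn x hx => ?_)
      (fun n => isClosed_eq (continuous_nsmul _) continuous_const) fun x => ?_
    · obtain ⟨k, hk⟩ := Nat.factorial_dvd_factorial hmn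
      change n.factorial • x = 0
      rw [hk, mul_nsmul, show m.factorial • x = 0 from hx, nsmul_zero]
    · exact ⟨addOrderOf x,
        addOrderOf_dvd_iff_nsmul_eq_zero.1 (Nat.dvd_factorial (h x).addOrderOf_pos le_rfl)⟩
  exact ⟨n.factorial, n.factorial_pos, fun x => (hn ▸ AddSubgroup.mem_top x : x ∈ H n)⟩

end CompactGroup

/-! ### Definable closures -/

section TupleOrbit

variable {R ι : Type*} [NonUnitalRing R] {G : Subgroup (RingAut R)}

/-- The orbit of a tuple of elements of a ring under a group of automorphisms, acting
coordinatewise. -/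
def tupleOrbit (G : Subgroup (RingAut R)) (a : ι → R) : Set (ι → R) :=
  {b | ∃ g ∈ G, ∀ i, b i = g (a i)}

theorem tupleOrbit_eq_iff {a b : ι → R} :
    tupleOrbit G a = tupleOrbit G b ↔ ∃ g ∈ G, ∀ i, b i = g (a i) := by
  constructor
  · intro h
    have hb : b ∈ tupleOrbit G b := ⟨1, one_mem _, fun _ => rfl⟩
    rwa [← h] at hb
  · rintro ⟨g, hg, hb⟩
    ext c
    constructor
    · rintro ⟨h, hh, hc⟩
      refine ⟨h * g⁻¹, mul_mem hh (inv_mem hg), fun i => ?_⟩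
      rw [hc, hb, RingAut.mul_apply]
      exact congrArg h (g.symm_apply_apply _).symm
    · rintro ⟨h, hh, hc⟩
      exact ⟨h * g, mul_mem hh hg, fun i => by rw [hc, hb, RingAut.mul_apply]⟩

end TupleOrbit

namespace SmallProfiniteStructure

variable {R : Type*} [NonUnitalRing R] [TopologicalSpace R] [IsTopologicalRing R]
  [CompactSpace R] [T2Space R]

theorem continuous_of_mem (s : SmallProfiniteStructure R) {g : RingAut R}
    (hg : g ∈ s.structuralGroup) : Continuous g := by
  refine continuous_of_continuousAt_zero g ?_
  rw [ContinuousAt, map_zero]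
  exact (s.basis_hasBasis.tendsto_iff s.basis_hasBasis).2 fun I hI =>
    ⟨I, hI, fun x => (s.structuralGroup_le hg I hI x).2⟩

/-- The subring of the elements fixed by the stabilizer of `x` in the structural group: the
definable closure of `x`, in the model-theoretic terminology. -/
def definableClosure (s : SmallProfiniteStructure R) (x : R) : NonUnitalSubring R where
  carrier := {y | ∀ g ∈ s.structuralGroup, g x = x → g y = y}
  zero_mem' := fun _ _ _ => map_zero _
  add_mem' := fun ha hb g hg hx => by rw [map_add, ha g hg hx, hb g hg hx]
  neg_mem' := fun ha g hg hx => by rw [map_neg, ha g hg hx]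
  mul_mem' := fun ha hb g hg hx => by rw [map_mul, ha g hg hx, hb g hg hx]

theorem mem_definableClosure_self (s : SmallProfiniteStructure R) (x : R) :
    x ∈ s.definableClosure x := fun _ _ h => h

theorem isClosed_definableClosure (s : SmallProfiniteStructure R) (x : R) :
    IsClosed (s.definableClosure x : Set R) := by
  have : (s.definableClosure x : Set R) =
      ⋂ g ∈ s.structuralGroup, ⋂ _ : g x = x, {y | g y = y} := by
    ext y
    simp only [Set.mem_iInter, Set.mem_ofPred_eq]
    rfl
  rw [this]
  exact isClosed_iInter fun g => isClosed_iInter fun hg => isClosed_iInter fun _ =>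
    isClosed_eq (s.continuous_of_mem hg) continuous_id

/-- An automorphism taking `(x, y)` to `(x, z)` fixes `x`, hence `y`, so `y` is determined by the
orbit of `(x, y)`. -/
theorem countable_definableClosure (s : SmallProfiniteStructure R) (x : R) :
    (s.definableClosure x : Set R).Countable := by
  refine Set.MapsTo.countable_of_injOn (f := fun y => tupleOrbit s.structuralGroup ![x, y])
    (fun y _ => Set.mem_range_self _) (fun y hy z _ hyz => ?_) (s.countable_orbits 2)
  obtain ⟨g, hg, h⟩ := tupleOrbit_eq_iff.1 hyz
  have hx : x = g x := h 0
  have hz : z = g y := h 1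
  rw [hz, hy g hg hx.symm]

theorem finite_definableClosure (s : SmallProfiniteStructure R) (x : R) :
    Finite (s.definableClosure x) := by
  have : CompactSpace (s.definableClosure x) :=
    isCompact_iff_compactSpace.1 (s.isClosed_definableClosure x).isCompact
  have : Countable (s.definableClosure x) := (s.countable_definableClosure x).to_subtype
  exact finite_of_countable_of_compactSpace

theorem exponentExists (s : SmallProfiniteStructure R) : AddMonoid.ExponentExists R := by
  refine exponentExists_of_forall_isOfFinAddOrder fun x => ?_
  have := s.finite_definableClosure x
  have h : IsOfFinAddOrder (⟨x, s.mem_definableClosure_self x⟩ : s.definableClosure x) :=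
    isOfFinAddOrder_of_finite _
  exact (NonUnitalSubringClass.subtype (s.definableClosure x)).toAddMonoidHom.isOfFinAddOrder h

end SmallProfiniteStructure

/-! ### The Jacobson radical -/

theorem isClosed_jacobsonRadical {R : Type*} [NonUnitalRing R] [TopologicalSpace R]
    [IsTopologicalRing R] [CompactSpace R] [T2Space R] : IsClosed (jacobsonRadical R) := by
  have : jacobsonRadical R =
      ⋂ y : R, Prod.fst '' {q : R × R | y * q.1 + q.2 + q.2 * y * q.1 = 0} := by
    ext x
    simp [jacobsonRadical]
  rw [this]
  refine isClosed_iInter fun y => (IsCompact.image ?_ continuous_fst).isClosed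
  exact (isClosed_eq (by fun_prop) continuous_const).isCompact

theorem map_mem_jacobsonRadical {R Q : Type*} [NonUnitalRing R] [NonUnitalRing Q]
    {π : R →ₙ+* Q} (hπ : Function.Surjective π) {x : R} (hx : x ∈ jacobsonRadical R) :
    π x ∈ jacobsonRadical Q := by
  refine hπ.forall.2 fun y => ?_
  obtain ⟨z, hz⟩ := hx y
  exact ⟨π z, by simpa using congrArg π hz⟩

theorem map_prodUpTo {R Q : Type*} [NonUnitalRing R] [NonUnitalRing Q] (π : R →ₙ+* Q)
    (r : ℕ → R) (n : ℕ) : π (prodUpTo r n) = prodUpTo (fun i => π (r i)) n := by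
  induction n with
  | zero => rfl
  | succ n ih => rw [prodUpTo, prodUpTo, map_mul, ih]

theorem pow_eq_zero_of_mem_jacobson_of_pow_eq_pow {A : Type*} [CommRing A] {a : A}
    (ha : a ∈ (⊥ : Ideal A).jacobson) {m n : ℕ} (hmn : m < n) (h : a ^ m = a ^ n) : a ^ m = 0 := by
  obtain ⟨d, rfl⟩ := Nat.exists_eq_add_of_lt hmn
  have hu : IsUnit (a * (-a ^ d) + 1) := Ideal.mem_jacobson_bot.1 ha _
  exact hu.mul_left_eq_zero.1 (by linear_combination h)

section Unitization

variable {k R : Type*} [CommRing k] [NonUnitalCommRing R] [Module k R] [IsScalarTower k R R]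
  [SMulCommClass k R R]

theorem inr_prodUpTo (r : ℕ → R) (n : ℕ) :
    ((prodUpTo r n : R) : Unitization k R) =
      ∏ i ∈ Finset.range (n + 1), (r i : Unitization k R) := by
  induction n with
  | zero => simp [prodUpTo]
  | succ n ih => rw [Finset.prod_range_succ, ← ih, prodUpTo, Unitization.inr_mul]

theorem isNilpotentSet_iff_isNilpotent_span (S : Set R) :
    IsNilpotentSet S ↔ IsNilpotent (Ideal.span ((↑) '' S : Set (Unitization k R))) := by
  have span_pow_eq_bot_iff (n : ℕ) : Ideal.span ((↑) '' S : Set (Unitization k R)) ^ (n + 1) = ⊥ ↔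
      ∀ r : ℕ → R, (∀ i, r i ∈ S) → prodUpTo r n = 0 := by
    rw [Ideal.span, Submodule.span_pow, Submodule.span_eq_bot]
    constructor
    · intro h r hr
      apply Unitization.inr_injective (R := k)
      rw [inr_prodUpTo, Unitization.inr_zero, Finset.prod_range]
      exact h _ (Set.mem_pow.2 ⟨fun i => ⟨r i, Set.mem_image_of_mem _ (hr i)⟩, List.prod_ofFn⟩)
    · intro h w hw
      obtain ⟨f, rfl⟩ := Set.mem_pow.1 hw
      choose r hrS hr using fun i => (f i).2
      rw [List.prod_ofFn]
      have h' := congrArg (fun y : R => (y : Unitization k R))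
        (h (fun i => r (Fin.ofNat (n + 1) i)) fun i => hrS _)
      rw [inr_prodUpTo, Finset.prod_range, Unitization.inr_zero] at h'
      simpa only [Fin.ofNat_val_eq_self, hr] using h'
  constructor
  · rintro ⟨n, hn⟩
    exact ⟨n + 1, (span_pow_eq_bot_iff n).2 hn⟩
  · rintro ⟨n, hn⟩
    exact ⟨n, (span_pow_eq_bot_iff n).1 (pow_eq_zero_of_le n.le_succ hn)⟩

omit [IsScalarTower k R R] [SMulCommClass k R R] in
theorem exists_inr_eq_mul_inr (b : Unitization k R) (x : R) :
    ∃ y : R, (y : Unitization k R) = b * x :=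
  ⟨b.fst • x + b.snd * x, by ext <;> simp⟩

theorem inr_mem_jacobson_bot {x : R} (hx : x ∈ jacobsonRadical R) :
    (x : Unitization k R) ∈ (⊥ : Ideal (Unitization k R)).jacobson := by
  have isUnit_one_add (y : R) : IsUnit (1 + (y : Unitization k R) * x) := by
    obtain ⟨z, hz⟩ := hx y
    have h := congrArg (fun w : R => (w : Unitization k R)) hz
    simp only [Unitization.inr_add, Unitization.inr_mul, Unitization.inr_zero] at h
    exact IsUnit.of_mul_eq_one (1 + (z : Unitization k R)) (by linear_combination h)
  refine Ideal.mem_jacobson_bot.2 fun b => ?_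
  -- `(1 + x b)(1 - x b) = 1 - (b² x) x`, where `b² x` lies in `R`.
  obtain ⟨y, hy⟩ := exists_inr_eq_mul_inr (-b ^ 2) x
  have hu := isUnit_one_add y
  rw [hy, show 1 + -b ^ 2 * (x : Unitization k R) * x = (x * b + 1) * (1 - x * b) by ring] at hu
  exact isUnit_of_mul_isUnit_left hu

theorem mem_jacobsonRadical_of_isNilpotent_inr {x : R} (hx : IsNilpotent (x : Unitization k R)) :
    x ∈ jacobsonRadical R := by
  intro y
  obtain ⟨v, hv⟩ := ((Commute.all (y : Unitization k R) x).isNilpotent_mul_left hx).isUnit_one_add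
    |>.exists_right_inv
  obtain ⟨z, hz⟩ := exists_inr_eq_mul_inr (-v * (y : Unitization k R)) x
  refine ⟨z, Unitization.inr_injective (R := k) ?_⟩
  simp only [Unitization.inr_add, Unitization.inr_mul, Unitization.inr_zero, hz]
  linear_combination (-(y : Unitization k R) * x) * hv

theorem exists_inr_of_isNilpotent [IsReduced k] {a : Unitization k R} (ha : IsNilpotent a) :
    ∃ x : R, (x : Unitization k R) = a := by
  have hfst : a.fst = 0 := (ha.map (Unitization.fstHom k R)).eq_zero
  exact ⟨a.snd, by rw [← Unitization.inl_fst_add_inr_snd_eq a, hfst]; simp⟩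

theorem SmallProfiniteStructure.isNilpotent_inr_of_mem_jacobsonRadical [TopologicalSpace R]
    [IsTopologicalRing R] [CompactSpace R] [T2Space R] (s : SmallProfiniteStructure R) {x : R}
    (hx : x ∈ jacobsonRadical R) : IsNilpotent (x : Unitization k R) := by
  have hmem (n : ℕ) : prodUpTo (fun _ => x) n ∈ s.definableClosure x := by
    induction n with
    | zero => exact s.mem_definableClosure_self x
    | succ n ih => exact mul_mem ih (s.mem_definableClosure_self x)
  have hfin : (s.definableClosure x : Set R).Finite := s.finite_definableClosure x
  obtain ⟨i, j, hij, h⟩ := hfin.exists_lt_map_eq_of_forall_mem hmem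
  have hpow : (x : Unitization k R) ^ (i + 1) = x ^ (j + 1) := by
    simpa [inr_prodUpTo] using congrArg (fun w : R => (w : Unitization k R)) h
  have hjac := inr_mem_jacobson_bot (k := k) hx
  exact ⟨i + 1, pow_eq_zero_of_mem_jacobson_of_pow_eq_pow hjac (Nat.succ_lt_succ hij) hpow⟩

theorem SmallProfiniteStructure.coe_nilradical_unitization [TopologicalSpace R]
    [IsTopologicalRing R] [CompactSpace R] [T2Space R] [IsReduced k]
    (s : SmallProfiniteStructure R) :
    (nilradical (Unitization k R) : Set (Unitization k R)) = (↑) '' jacobsonRadical R := by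
  ext a
  constructor
  · intro ha
    obtain ⟨x, rfl⟩ := exists_inr_of_isNilpotent ha
    exact ⟨x, mem_jacobsonRadical_of_isNilpotent_inr ha, rfl⟩
  · rintro ⟨x, hx, rfl⟩
    exact s.isNilpotent_inr_of_mem_jacobsonRadical hx

theorem SmallProfiniteStructure.isNilpotentSet_jacobsonRadical_iff [TopologicalSpace R]
    [IsTopologicalRing R] [CompactSpace R] [T2Space R] [IsReduced k]
    (s : SmallProfiniteStructure R) :
    IsNilpotentSet (jacobsonRadical R) ↔ IsNilpotent (nilradical (Unitization k R)) := by
  rw [isNilpotentSet_iff_isNilpotent_span (k := k), ← s.coe_nilradical_unitization,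
    Ideal.span_eq]

end Unitization

/-! ### Quotients of small profinite rings -/

section Surjective

variable {R Q T : Type*} [NonUnitalRing R] [NonUnitalRing Q] [NonUnitalRing T]

/-- The homomorphism `Q →ₙ+* T` through which `f : R →ₙ+* T` factors, when `π : R →ₙ+* Q` is
surjective and `f` vanishes on its kernel. -/
def liftOfSurjective (π : R →ₙ+* Q) (hπ : Function.Surjective π) (f : R →ₙ+* T)
    (h : ∀ x, π x = 0 → f x = 0) : Q →ₙ+* T :=
  have lift_apply (x : R) : f (Function.surjInv hπ (π x)) = f x := by
    rw [← sub_eq_zero, ← map_sub]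
    exact h _ (by rw [map_sub, Function.surjInv_eq hπ, sub_self])
  { toFun q := f (Function.surjInv hπ q)
    map_zero' := h _ (Function.surjInv_eq hπ 0)
    map_add' := hπ.forall₂.2 fun x y => by simp only [← map_add, lift_apply]
    map_mul' := hπ.forall₂.2 fun x y => by simp only [← map_mul, lift_apply] }

theorem liftOfSurjective_apply (π : R →ₙ+* Q) (hπ : Function.Surjective π) (f : R →ₙ+* T)
    (h : ∀ x, π x = 0 → f x = 0) (x : R) : liftOfSurjective π hπ f h (π x) = f x := by
  change f (Function.surjInv hπ (π x)) = f x
  rw [← sub_eq_zero, ← map_sub]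
  exact h _ (by rw [map_sub, Function.surjInv_eq hπ, sub_self])

theorem coe_map_of_surjective {π : R →ₙ+* Q} (hπ : Function.Surjective π) (I : TwoSidedIdeal R) :
    (I.map π : Set Q) = π '' I := by
  let J : TwoSidedIdeal Q := TwoSidedIdeal.mk' (π '' I) ⟨0, I.zero_mem, map_zero π⟩
    (by rintro _ _ ⟨x, hx, rfl⟩ ⟨y, hy, rfl⟩; exact ⟨x + y, I.add_mem hx hy, map_add π x y⟩)
    (by rintro _ ⟨x, hx, rfl⟩; exact ⟨-x, I.neg_mem hx, map_neg π x⟩)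
    (by
      rintro q _ ⟨y, hy, rfl⟩
      obtain ⟨x, rfl⟩ := hπ q
      exact ⟨x * y, I.mul_mem_left x y hy, map_mul π x y⟩)
    (by
      rintro _ q ⟨x, hx, rfl⟩
      obtain ⟨y, rfl⟩ := hπ q
      exact ⟨x * y, I.mul_mem_right x y hx, map_mul π x y⟩)
  have hJ : (J : Set Q) = π '' I := TwoSidedIdeal.coe_mk' ..
  exact subset_antisymm (hJ ▸ TwoSidedIdeal.span_le.2 hJ.ge) TwoSidedIdeal.subset_span

/-- The automorphism of a quotient induced by an automorphism preserving the kernel. -/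
def inducedAut (π : R →ₙ+* Q) (hπ : Function.Surjective π) (g : RingAut R)
    (hg : ∀ x, π (g x) = 0 ↔ π x = 0) : RingAut Q :=
  RingEquiv.ofBijective
    (liftOfSurjective π hπ (π.comp (g : R →ₙ+* R)) fun x => (hg x).2)
    ⟨(injective_iff_map_eq_zero _).2 <| hπ.forall.2 fun x hx =>
      (hg x).1 ((liftOfSurjective_apply _ hπ _ _ x).symm.trans hx),
    hπ.forall.2 <| g.surjective.forall.2 fun x => ⟨π x, liftOfSurjective_apply _ hπ _ _ x⟩⟩

variable {π : R →ₙ+* Q} {hπ : Function.Surjective π} {g : RingAut R}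
  {hg : ∀ x, π (g x) = 0 ↔ π x = 0}

theorem inducedAut_apply (x : R) : inducedAut π hπ g hg (π x) = π (g x) :=
  liftOfSurjective_apply π hπ (π.comp (g : R →ₙ+* R)) (fun x => (hg x).2) x

theorem inducedAut_mem_standardAut {B : Set (TwoSidedIdeal R)} (hgB : g ∈ standardAut B) :
    inducedAut π hπ g hg ∈ standardAut (TwoSidedIdeal.map π '' B) := by
  rintro _ ⟨I, hI, rfl⟩
  refine hπ.forall.2 fun x => ?_
  simp only [← SetLike.mem_coe, coe_map_of_surjective hπ]
  constructor
  · rintro ⟨y, hy, hyx⟩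
    obtain ⟨y, rfl⟩ := g.surjective y
    exact ⟨y, (hgB I hI y).1 hy,
      (inducedAut π hπ g hg).injective ((inducedAut_apply y).trans hyx)⟩
  · rintro ⟨y, hy, hyx⟩
    exact ⟨g y, (hgB I hI y).2 hy, by rw [← hyx, inducedAut_apply]⟩

variable [TopologicalSpace R] [IsTopologicalRing R] [CompactSpace R] [T2Space R]

theorem SmallProfiniteStructure.countable_tupleOrbit_map (s : SmallProfiniteStructure R)
    (hπ : Function.Surjective π) (hker : ∀ g ∈ s.structuralGroup, ∀ x, π (g x) = 0 ↔ π x = 0)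
    (n : ℕ) : (Set.range fun b : Fin n → Q =>
      tupleOrbit (standardAut (TwoSidedIdeal.map π '' s.basis)) b).Countable := by
  set H := standardAut (TwoSidedIdeal.map π '' s.basis)
  have hfactors : Function.FactorsThrough (fun a : Fin n → R => tupleOrbit H (π ∘ a))
      (tupleOrbit s.structuralGroup) := by
    intro a b hab
    obtain ⟨g, hg, hb⟩ := tupleOrbit_eq_iff.1 hab
    exact tupleOrbit_eq_iff.2 ⟨inducedAut π hπ g (hker g hg),
      inducedAut_mem_standardAut (s.structuralGroup_le hg),
      fun i => by simp only [Function.comp_apply, hb, inducedAut_apply]⟩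
  obtain ⟨F, hF⟩ := (Function.factorsThrough_iff _).1 hfactors
  rw [← (hπ.comp_left (α := Fin n)).range_comp, Function.comp_def, hF, Set.range_comp]
  exact (s.countable_orbits n).image F

variable [TopologicalSpace Q] [IsTopologicalRing Q] [CompactSpace Q] [T2Space Q]

/-- The structure of small profinite ring on a quotient by an invariant ideal: the distinguished
ideals are the images of those of `R`, and the structural group is as large as possible. -/
def SmallProfiniteStructure.map (s : SmallProfiniteStructure R) (π : R →ₙ+* Q)
    (hπ : IsOpenQuotientMap π)
    (hker : ∀ g ∈ s.structuralGroup, ∀ x, π (g x) = 0 ↔ π x = 0) : SmallProfiniteStructure Q where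
  basis := TwoSidedIdeal.map π '' s.basis
  basis_countable := s.basis_countable.image _
  basis_isOpen := by
    rintro _ ⟨I, hI, rfl⟩
    rw [coe_map_of_surjective hπ.surjective]
    exact hπ.isOpenMap _ (s.basis_isOpen I hI)
  basis_hasBasis := by
    have h := s.basis_hasBasis.map π
    rw [hπ.map_nhds_eq, map_zero] at h
    refine h.to_hasBasis (fun I hI => ⟨_, ⟨I, hI, rfl⟩, (coe_map_of_surjective hπ.surjective I).le⟩)
      ?_
    rintro _ ⟨I, hI, rfl⟩
    exact ⟨I, hI, (coe_map_of_surjective hπ.surjective I).ge⟩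
  structuralGroup := standardAut (TwoSidedIdeal.map π '' s.basis)
  structuralGroup_le := le_rfl
  structuralGroup_closed := by
    let := standardAutTopology (TwoSidedIdeal.map π '' s.basis)
    simpa only [SetLike.coe_mem, Set.ofPred_true] using isClosed_univ
  countable_orbits := s.countable_tupleOrbit_map hπ.surjective hker

end Surjective

section Quotient

variable {R : Type*} [NonUnitalRing R] (I : TwoSidedIdeal R)

/-- The quotient map by an ideal. -/
def quotientHom : R →ₙ+* I.ringCon.Quotient where
  toFun x := x
  map_zero' := rfl
  map_add' _ _ := rfl
  map_mul' _ _ := rfl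

theorem quotientHom_surjective : Function.Surjective (quotientHom I) :=
  Quotient.mk''_surjective

variable {I}

theorem quotientHom_eq_iff {x y : R} : quotientHom I x = quotientHom I y ↔ x - y ∈ I :=
  (RingCon.eq I.ringCon).trans (TwoSidedIdeal.rel_iff I x y)

theorem quotientHom_eq_zero_iff {x : R} : quotientHom I x = 0 ↔ x ∈ I := by
  rw [← map_zero (quotientHom I), quotientHom_eq_iff, sub_zero]

variable (I) [TopologicalSpace R]

instance : TopologicalSpace I.ringCon.Quotient := TopologicalSpace.coinduced (quotientHom I) ‹_›

instance [CompactSpace R] : CompactSpace I.ringCon.Quotient :=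
  (quotientHom_surjective I).compactSpace continuous_coinduced_rng

variable [IsTopologicalRing R]

theorem isOpenQuotientMap_quotientHom : IsOpenQuotientMap (quotientHom I) :=
  AddMonoidHom.isOpenQuotientMap_of_isQuotientMap ⟨⟨rfl⟩, quotientHom_surjective I⟩

instance : IsTopologicalRing I.ringCon.Quotient :=
  have ho := isOpenQuotientMap_quotientHom I
  { continuous_add := (ho.prodMap ho).isQuotientMap.continuous_iff.2
      (ho.continuous.comp continuous_add)
    continuous_mul := (ho.prodMap ho).isQuotientMap.continuous_iff.2
      (ho.continuous.comp continuous_mul)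
    continuous_neg := ho.isQuotientMap.continuous_iff.2 (ho.continuous.comp continuous_neg) }

variable {I}

theorem t2Space_quotient (hI : IsClosed (I : Set R)) : T2Space I.ringCon.Quotient := by
  rw [t2Space_iff_of_isOpenQuotientMap (isOpenQuotientMap_quotientHom I)]
  simp only [quotientHom_eq_iff]
  exact hI.preimage (continuous_fst.sub continuous_snd)

end Quotient

/-! ### Reduction to prime characteristic -/

section Reduction

variable {R : Type*} [NonUnitalRing R]

theorem prodUpTo_add (r : ℕ → R) (a b : ℕ) :
    prodUpTo r (a + b + 1) = prodUpTo r a * prodUpTo (fun i => r (a + 1 + i)) b := by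
  induction b with
  | zero => rfl
  | succ b ih =>
    rw [← add_assoc, prodUpTo, ih, mul_assoc, prodUpTo]
    congr 3
    ring

theorem isNilpotentSet_of_forall_prime (hR : AddMonoid.ExponentExists R) {S : Set R}
    (h : ∀ p : ℕ, p.Prime → ∃ n : ℕ, ∀ r : ℕ → R, (∀ i, r i ∈ S) → ∃ y, prodUpTo r n = p • y) :
    IsNilpotentSet S := by
  obtain ⟨N, hN, hR⟩ := hR
  suffices H : ∀ N : ℕ, 0 < N → ∃ n : ℕ, ∀ r : ℕ → R, (∀ i, r i ∈ S) → ∃ y, prodUpTo r n = N • y by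
    obtain ⟨n, hn⟩ := H N hN
    refine ⟨n, fun r hr => ?_⟩
    obtain ⟨y, hy⟩ := hn r hr
    rw [hy, hR]
  intro N
  induction N using Nat.recOnMul with
  | zero => exact fun h => absurd h (lt_irrefl 0)
  | one => exact fun _ => ⟨0, fun r _ => ⟨r 0, (one_nsmul _).symm⟩⟩
  | prime p hp => exact fun _ => h p hp
  | mul m n hm hn =>
    intro hmn
    obtain ⟨a, ha⟩ := hm (Nat.pos_of_mul_pos_right hmn)
    obtain ⟨b, hb⟩ := hn (Nat.pos_of_mul_pos_left hmn)
    refine ⟨a + b + 1, fun r hr => ?_⟩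
    obtain ⟨y, hy⟩ := ha r hr
    obtain ⟨z, hz⟩ := hb (fun i => r (a + 1 + i)) fun i => hr _
    exact ⟨y * z, by rw [prodUpTo_add, hy, hz, smul_mul_smul_comm]⟩

/-- The ideal `nR`. -/
def multiplesIdeal (R : Type*) [NonUnitalRing R] (n : ℕ) : TwoSidedIdeal R :=
  TwoSidedIdeal.mk' (Set.range fun y : R => n • y) ⟨0, nsmul_zero n⟩
    (by rintro _ _ ⟨x, rfl⟩ ⟨y, rfl⟩; exact ⟨x + y, nsmul_add x y n⟩)
    (by rintro _ ⟨x, rfl⟩; exact ⟨-x, neg_nsmul x n⟩)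
    (by rintro x _ ⟨y, rfl⟩; exact ⟨x * y, (mul_smul_comm n x y).symm⟩)
    (by rintro _ y ⟨x, rfl⟩; exact ⟨x * y, (smul_mul_assoc n x y).symm⟩)

theorem mem_multiplesIdeal {n : ℕ} {x : R} : x ∈ multiplesIdeal R n ↔ ∃ y, n • y = x :=
  TwoSidedIdeal.mem_mk' ..

theorem nsmul_quotient_multiplesIdeal {n : ℕ} (q : (multiplesIdeal R n).ringCon.Quotient) :
    n • q = 0 := by
  obtain ⟨x, rfl⟩ := quotientHom_surjective _ q
  rw [← map_nsmul, quotientHom_eq_zero_iff]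
  exact mem_multiplesIdeal.2 ⟨x, rfl⟩

theorem map_mem_multiplesIdeal_iff {n : ℕ} (g : RingAut R) {x : R} :
    g x ∈ multiplesIdeal R n ↔ x ∈ multiplesIdeal R n := by
  rw [mem_multiplesIdeal, mem_multiplesIdeal, g.surjective.exists]
  simp only [← map_nsmul, g.injective.eq_iff]

variable [TopologicalSpace R] [IsTopologicalRing R] [CompactSpace R] [T2Space R]

theorem isClosed_multiplesIdeal (n : ℕ) : IsClosed (multiplesIdeal R n : Set R) := by
  have : (multiplesIdeal R n : Set R) = Set.range fun y : R => n • y := TwoSidedIdeal.coe_mk' ..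
  exact this ▸ (isCompact_range (continuous_nsmul n)).isClosed

instance (n : ℕ) : T2Space (multiplesIdeal R n).ringCon.Quotient :=
  t2Space_quotient (isClosed_multiplesIdeal n)

/-- The structure of small profinite ring on `R / nR`. -/
def SmallProfiniteStructure.quotientMultiples (s : SmallProfiniteStructure R) (n : ℕ) :
    SmallProfiniteStructure (multiplesIdeal R n).ringCon.Quotient :=
  s.map (quotientHom _) (isOpenQuotientMap_quotientHom _) fun g _ x => by
    simp only [quotientHom_eq_zero_iff, map_mem_multiplesIdeal_iff]

theorem SmallProfiniteStructure.exists_prime_not_isNilpotentSet (s : SmallProfiniteStructure R)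
    (h : ¬ IsNilpotentSet (jacobsonRadical R)) : ∃ p : ℕ, p.Prime ∧
      ¬ IsNilpotentSet (jacobsonRadical (multiplesIdeal R p).ringCon.Quotient) := by
  contrapose! h
  refine isNilpotentSet_of_forall_prime s.exponentExists fun p hp => ?_
  obtain ⟨n, hn⟩ := h p hp
  refine ⟨n, fun r hr => ?_⟩
  have hmem := hn _ fun i => map_mem_jacobsonRadical (quotientHom_surjective _) (hr i)
  rw [← map_prodUpTo, quotientHom_eq_zero_iff, mem_multiplesIdeal] at hmem
  exact hmem.imp fun _ => Eq.symm

end Reduction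

/-! ### Polarization -/

section Polarization

open Polynomial
open scoped Nat

variable {A : Type*} [CommRing A]

theorem coeff_taylor_sub_self {f : A[X]} {k : ℕ} (hf : f.natDegree ≤ k + 1) (y : A) :
    (taylor y f - f).coeff k = (k + 1) * f.coeff (k + 1) * y := by
  have hderiv : hasseDeriv k f = C (f.coeff k) + C ((k + 1) * f.coeff (k + 1)) * X := by
    ext n
    rcases n with _ | _ | n
    · simp [hasseDeriv_coeff]
    · simp [hasseDeriv_coeff, add_comm 1 k]
    · rw [hasseDeriv_coeff, coeff_eq_zero_of_natDegree_lt (by omega)]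
      simp [coeff_one]
  rw [coeff_sub, taylor_coeff, hderiv]
  simp

theorem natDegree_taylor_sub_self_le {f : A[X]} {k : ℕ} (hf : f.natDegree ≤ k + 1) (y : A) :
    (taylor y f - f).natDegree ≤ k := by
  rcases eq_or_ne (taylor y f - f) 0 with h0 | h0
  · simp [h0]
  have hf0 : f ≠ 0 := by
    rintro rfl
    simp at h0
  have hlt : (taylor y f - f).degree < f.degree :=
    degree_taylor f y ▸ degree_sub_lt_left (degree_taylor f y) (by simpa) (leadingCoeff_taylor y f)
  have := natDegree_lt_natDegree h0 hlt
  omega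

theorem factorial_mul_coeff_mul_eq_zero {I : Ideal A} {f : A[X]} {k : ℕ} (hdeg : f.natDegree ≤ k)
    (hf : ∀ y ∈ I, f.eval y = 0) : ∀ z ∈ I ^ k, k ! * f.coeff k * z = 0 := by
  induction k generalizing f with
  | zero =>
    intro z _
    have h0 := hf 0 I.zero_mem
    rw [← coeff_zero_eq_eval_zero] at h0
    rw [h0, mul_zero, zero_mul]
  | succ k ih =>
    intro z hz
    rw [pow_succ'] at hz
    refine Submodule.mul_induction_on hz (fun y hy z hz => ?_) fun z w hz hw => by
      rw [mul_add, hz, hw, add_zero]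
    have h := ih (natDegree_taylor_sub_self_le hdeg y) (fun x hx => by
      rw [eval_sub, taylor_eval, hf _ (I.add_mem hx hy), hf x hx, sub_zero]) z hz
    rw [coeff_taylor_sub_self hdeg] at h
    rw [Nat.factorial_succ]
    push_cast
    linear_combination h

theorem mul_eq_zero_of_forall_mul_add_pow_eq_zero (p : ℕ) [Fact p.Prime] [CharP A p]
    {I : Ideal A} {w b : A} (h : ∀ y ∈ I, w * (b + y) ^ (p - 1) = 0) :
    ∀ z ∈ I ^ (p - 1), w * z = 0 := by
  intro z hz
  have hmonic : ((X + C b) ^ (p - 1) : A[X]).coeff (p - 1) = 1 := by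
    simp [coeff_X_add_C_pow]
  have hzero := factorial_mul_coeff_mul_eq_zero (f := C w * (X + C b) ^ (p - 1)) (k := p - 1)
    (by compute_degree) (fun y hy => by simpa [add_comm y b] using h y hy) z hz
  have hwilson : ((p - 1)! : A) = -1 := by
    rw [← map_natCast (ZMod.castHom dvd_rfl A), ZMod.wilsons_lemma, map_neg, map_one]
  rw [coeff_C_mul, hmonic, hwilson] at hzero
  linear_combination -hzero

end Polarization

/-! ### Compact rings with a nilradical that is not nilpotent -/

section Compact

open Topology

variable {A : Type*} [CommRing A] [TopologicalSpace A] [IsTopologicalRing A] [CompactSpace A]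

theorem exists_nilradical_pow_le {U : Ideal A} (hU : IsOpen (U : Set A)) :
    ∃ l, nilradical A ^ l ≤ U := by
  have : Finite (A ⧸ U) := AddSubgroup.quotient_finite_of_isOpen U.toAddSubgroup hU
  obtain ⟨l, hl⟩ := IsNoetherianRing.isNilpotent_nilradical (A ⧸ U)
  have hmap : (nilradical A).map (Ideal.Quotient.mk U) ≤ nilradical (A ⧸ U) :=
    Ideal.map_le_iff_le_comap.2 fun x hx => (mem_nilradical.1 hx).map (Ideal.Quotient.mk U)
  have hpow := Ideal.pow_right_mono hmap l
  rw [hl, ← Ideal.map_pow, Ideal.map_le_iff_le_comap] at hpow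
  exact ⟨l, fun x hx => Ideal.Quotient.eq_zero_iff_mem.1 (hpow hx)⟩

variable [T2Space A] {V : ℕ → Ideal A} (hV : (𝓝 (0 : A)).HasAntitoneBasis fun n => (V n : Set A))

include hV

omit [CompactSpace A] [T2Space A] in
theorem isOpen_of_hasAntitoneBasis (n : ℕ) : IsOpen (V n : Set A) :=
  (V n).toAddSubgroup.isOpen_of_mem_nhds (hV.mem n)

omit [IsTopologicalRing A] [CompactSpace A] in
theorem exists_notMem_of_ne_zero {x : A} (hx : x ≠ 0) : ∃ n, x ∉ V n := by
  obtain ⟨n, hn⟩ := hV.mem_iff.1 (isOpen_compl_singleton.mem_nhds hx.symm)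
  exact ⟨n, fun h => hn h rfl⟩

omit [T2Space A] in
theorem exists_forall_add_mem_of_subset_iUnion {T : Ideal A} (hT : IsClosed (T : Set A))
    {B : ℕ → Set A} (hB : ∀ m, IsClosed (B m)) (hTB : (T : Set A) ⊆ ⋃ m, B m) :
    ∃ m b n, ∀ y ∈ T ⊓ V n, b + y ∈ B m := by
  have : CompactSpace T := isCompact_iff_compactSpace.1 hT.isCompact
  obtain ⟨m, b, hb⟩ := nonempty_interior_of_iUnion_of_closed (f := fun m => ((↑) : T → A) ⁻¹' B m)
    (fun m => (hB m).preimage continuous_subtype_val)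
    (by simpa [Set.eq_univ_iff_forall, Set.subset_def] using hTB)
  have hb0 : (fun y : T => b + y) ⁻¹' ((↑) ⁻¹' B m) ∈ 𝓝 0 :=
    (continuous_const_add b).continuousAt.preimage_mem_nhds
      (by simpa using mem_interior_iff_mem_nhds.1 hb)
  obtain ⟨W, hW, hWB⟩ := mem_nhds_induced _ _ _ |>.1 hb0
  obtain ⟨n, hn⟩ := hV.mem_iff.1 hW
  exact ⟨m, b, n, fun y hy => hWB (a := ⟨y, hy.1⟩) (hn hy.2)⟩

variable (p : ℕ) [Fact p.Prime] [CharP A p] {K : Ideal A} (hK : IsClosed (K : Set A))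
  (hnil : K ≤ nilradical A)

include hK hnil

theorem exists_mul_pow_notMem_annihilator {u : A} (hu : ∀ m, u ∉ (K ^ m).annihilator) (k : ℕ) :
    ∃ a ∈ K ⊓ V k, ∀ m, u * a ^ (p - 1) ∉ (K ^ m).annihilator := by
  by_contra! hcon
  have hVclosed := (V k).toAddSubgroup.isClosed_of_isOpen (isOpen_of_hasAntitoneBasis hV k)
  obtain ⟨m, b, n, hb⟩ := exists_forall_add_mem_of_subset_iUnion hV (T := K ⊓ V k)
    (hK.inter hVclosed) (B := fun m => ⋂ x ∈ K ^ m, {a | u * a ^ (p - 1) * x = 0})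
    (fun m => isClosed_biInter fun x _ => isClosed_eq (by fun_prop) continuous_const)
    (fun a ha => by simpa [Submodule.mem_annihilator] using hcon a ha)
  have hopen : IsOpen ((V k ⊓ V n : Ideal A) : Set A) :=
    (isOpen_of_hasAntitoneBasis hV k).inter (isOpen_of_hasAntitoneBasis hV n)
  obtain ⟨l, hl⟩ := exists_nilradical_pow_le hopen
  have hKl : K ^ (l + 1) ≤ K ⊓ V k ⊓ V n := by
    rw [inf_assoc]
    exact le_inf (Ideal.pow_le_self l.succ_ne_zero)
      ((Ideal.pow_le_pow_right l.le_succ).trans ((Ideal.pow_right_mono hnil l).trans hl))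
  refine hu (m + (l + 1) * (p - 1)) ?_
  rw [pow_add, Submodule.mem_annihilator]
  intro z hz
  refine Submodule.mul_induction_on hz (fun x hx y hy => ?_) fun x y hx hy => by
    rw [smul_add, hx, hy, add_zero]
  rw [smul_eq_mul, ← mul_assoc]
  refine mul_eq_zero_of_forall_mul_add_pow_eq_zero p (I := K ⊓ V k ⊓ V n) (b := b)
    (fun y hy => ?_) y (Ideal.pow_right_mono hKl _ (pow_mul K _ _ ▸ hy))
  rw [mul_right_comm]
  exact Set.mem_iInter₂.1 (hb y hy) x hx

/-- The products `∏ i < n, aᵢ ^ (p - 1)` are kept away from every annihilator `Ann (K ^ m)`, so that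
the sequence can be continued. -/
theorem exists_prod_pow_notMem (hK' : ¬ IsNilpotent K) :
    ∃ (a : ℕ → A) (k : ℕ → ℕ), StrictMono k ∧ (∀ n, a n ∈ K ⊓ V (k n)) ∧
      ∀ n, ∏ i ∈ Finset.range n, a i ^ (p - 1) ∉ V (k n) := by
  let State := {s : A × ℕ // (∀ m, s.1 ∉ (K ^ m).annihilator) ∧ s.1 ∉ V s.2}
  have hne : ∀ {u : A}, (∀ m, u ∉ (K ^ m).annihilator) → u ≠ 0 := by
    rintro _ hu rfl
    exact hu 0 (zero_mem _)
  have hstep : ∀ s : State, ∃ (a : A) (t : State), a ∈ K ⊓ V s.1.2 ∧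
      t.1.1 = s.1.1 * a ^ (p - 1) ∧ s.1.2 < t.1.2 := by
    rintro ⟨⟨u, k⟩, hu, -⟩
    obtain ⟨a, ha, hua⟩ := exists_mul_pow_notMem_annihilator hV p hK hnil hu k
    obtain ⟨n, hn⟩ := exists_notMem_of_ne_zero hV (hne hua)
    refine ⟨a, ⟨⟨u * a ^ (p - 1), max n (k + 1)⟩, hua, fun h => hn ?_⟩, ha, rfl, ?_⟩
    · exact hV.antitone (le_max_left _ _) h
    · exact Nat.lt_of_succ_le (le_max_right _ _)
  choose a next ha hmul hlt using hstep
  have hone : ∀ m, (1 : A) ∉ (K ^ m).annihilator := fun m h => hK' ⟨m, by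
    simpa [Submodule.mem_annihilator, Submodule.eq_bot_iff] using h⟩
  obtain ⟨k₀, hk₀⟩ := exists_notMem_of_ne_zero hV (hne hone)
  let s : ℕ → State := fun n => next^[n] ⟨(1, k₀), hone, hk₀⟩
  have hs : ∀ n, s (n + 1) = next (s n) := fun n => Function.iterate_succ_apply' _ _ _
  have hprod : ∀ n, (s n).1.1 = ∏ i ∈ Finset.range n, a (s i) ^ (p - 1) := by
    intro n
    induction n with
    | zero => rfl
    | succ n ih => rw [hs, hmul, ih, Finset.prod_range_succ]
  refine ⟨fun n => a (s n), fun n => (s n).1.2, strictMono_nat_of_lt_succ fun n => ?_,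
    fun n => ha _, fun n => ?_⟩
  · rw [hs]
    exact hlt _
  · rw [← hprod]
    exact (s n).2.2

end Compact

/-! ### Evaluation of polynomials at nilpotent elements -/

section Monomial

open MvPolynomial

variable {σ k B : Type*} [Field k] [CommRing B] [Algebra k B] {a : σ → B} {q : σ →₀ ℕ}

theorem prod_pow_eq_zero_of_lt (ha : ∀ i, a i ^ (q i + 1) = 0) {r : σ →₀ ℕ} {i : σ}
    (hi : q i < r i) : (r.prod fun i e => a i ^ e) = 0 :=
  Finset.prod_eq_zero (Finsupp.mem_support_iff.2 (Nat.ne_zero_of_lt hi))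
    (pow_eq_zero_of_le hi (ha i))

/-- Multiplying a polynomial by the monomial of exponent `q - s`, for a minimal exponent `s ≤ q` in
its support, leaves only the value of the monomial of exponent `q`. -/
theorem not_le_of_mem_support_of_aeval_eq_zero (ha : ∀ i, a i ^ (q i + 1) = 0)
    (hq : (q.prod fun i e => a i ^ e) ≠ 0) {P : MvPolynomial σ k} (hP : aeval a P = 0)
    {s : σ →₀ ℕ} (hs : s ∈ P.support) : ¬ s ≤ q := by
  classical
  intro hsq
  obtain ⟨t, ht, htmin⟩ :=
    (P.support.filter (· ≤ q)).exists_minimal ⟨s, Finset.mem_filter.2 ⟨hs, hsq⟩⟩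
  obtain ⟨htP, htq⟩ := Finset.mem_filter.1 ht
  have hvanish : ∀ r ∈ P.support, r ≠ t → ((r + (q - t)).prod fun i e => a i ^ e) = 0 := by
    intro r hr hrt
    obtain ⟨i, hi⟩ : ∃ i, t i < r i := by
      by_contra! hle
      have hrt' : r ≤ t := hle
      exact hrt (hrt'.antisymm (htmin (Finset.mem_filter.2 ⟨hr, hrt'.trans htq⟩) hrt'))
    refine prod_pow_eq_zero_of_lt ha (i := i) ?_
    have := htq i
    simp only [Finsupp.add_apply, Finsupp.tsub_apply]
    omega
  have hsum : aeval a (P * monomial (q - t) 1) = coeff t P • q.prod fun i e => a i ^ e := by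
    conv_lhs => rw [P.as_sum, Finset.sum_mul, map_sum]
    rw [Finset.sum_eq_single_of_mem t htP fun r hr hrt => ?_]
    · rw [monomial_mul, mul_one, add_tsub_cancel_of_le htq, aeval_monomial, Algebra.smul_def]
    · rw [monomial_mul, aeval_monomial, hvanish r hr hrt, mul_zero]
  rw [map_mul, hP, zero_mul] at hsum
  exact smul_ne_zero (mem_support_iff.1 htP) hq hsum.symm

theorem ker_aeval_le_span (ha : ∀ i, a i ^ (q i + 1) = 0) (hq : (q.prod fun i e => a i ^ e) ≠ 0) :
    RingHom.ker (aeval a : MvPolynomial σ k →ₐ[k] B) ≤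
      Ideal.span (Set.range fun i => X i ^ (q i + 1)) := by
  intro P hP
  have hrange : (Set.range fun i => (X i ^ (q i + 1) : MvPolynomial σ k)) =
      (fun s => monomial s 1) '' Set.range fun i => Finsupp.single i (q i + 1) := by
    simp only [X_pow_eq_monomial, ← Set.range_comp, Function.comp_def]
  rw [hrange, mem_ideal_span_monomial_image]
  intro s hs
  obtain ⟨i, hi⟩ := not_forall.1 (not_le_of_mem_support_of_aeval_eq_zero ha hq hP hs)
  exact ⟨_, ⟨i, rfl⟩, Finsupp.single_le_iff.2 (not_le.1 hi)⟩

end Monomial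

section ImageIdeal

variable {R B : Type*} [NonUnitalRing R] [Ring B]

/-- The image of an ideal of `R` in a ring `B` generated by the image of `R` and the identity. -/
def imageIdeal (φ : R →ₙ+* B) (hφ : ∀ b, ∃ (n : ℤ) (r : R), b = n + φ r) (I : TwoSidedIdeal R) :
    Ideal B where
  __ := ((AddSubgroup.ofClass I).map (φ : R →+ B)).toAddSubmonoid
  smul_mem' := by
    rintro b _ ⟨x, hx, rfl⟩
    obtain ⟨n, r, rfl⟩ := hφ b
    refine ⟨n • x + r * x, I.add_mem (I.zsmul_mem n hx) (I.mul_mem_left r x hx), ?_⟩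
    simp [add_mul]

theorem coe_imageIdeal (φ : R →ₙ+* B) (hφ : ∀ b, ∃ (n : ℤ) (r : R), b = n + φ r)
    (I : TwoSidedIdeal R) : (imageIdeal φ hφ I : Set B) = φ '' I :=
  rfl

end ImageIdeal

namespace FreeNil

open MvPolynomial

/-- The inclusion of the polynomials without constant term into all polynomials. -/
def polyInclusion (p : ℕ) : PolyNoConst p →ₙ+* MvPolynomial ℕ (ZMod p) :=
  NonUnitalSubringClass.subtype (RingHom.ker (constantCoeff (R := ZMod p) (σ := ℕ)))

theorem exists_eq_intCast_add_polyInclusion (p : ℕ) (P : MvPolynomial ℕ (ZMod p)) :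
    ∃ (n : ℤ) (f : PolyNoConst p), P = n + polyInclusion p f := by
  obtain ⟨n, hn⟩ := ZMod.intCast_surjective (constantCoeff P)
  refine ⟨n, ⟨P - n, ?_⟩, (add_sub_cancel _ P).symm⟩
  rw [RingHom.mem_ker, map_sub, map_intCast, hn, sub_self]

theorem mem_tailIdeal_of_mem_span {p n : ℕ} {q : ℕ → ℕ} (hq : ∀ i < n, q i + 1 = p)
    {f : PolyNoConst p}
    (hf : polyInclusion p f ∈ Ideal.span (Set.range fun i => X i ^ (q i + 1))) :
    quotientHom (powerIdeal p) f ∈ tailIdeal p n := by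
  let J := imageIdeal (polyInclusion p) (exists_eq_intCast_add_polyInclusion p)
    ((tailIdeal p n).comap (quotientHom (powerIdeal p)))
  have hle : Ideal.span (Set.range fun i => X i ^ (q i + 1)) ≤ J := by
    refine Ideal.span_le.2 ?_
    rintro _ ⟨i, rfl⟩
    let x_i : PolyNoConst p := ⟨X i, constantCoeff_X _ i⟩
    rcases lt_or_ge i n with hin | hin
    · refine ⟨⟨X i ^ (q i + 1), Ideal.pow_mem_of_mem _ x_i.2 _ (Nat.succ_pos _)⟩, ?_, rfl⟩
      refine (TwoSidedIdeal.mem_comap _).2 ?_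
      refine (quotientHom_eq_zero_iff.2 ?_ : quotientHom (powerIdeal p) _ = 0) ▸ zero_mem _
      exact TwoSidedIdeal.subset_span ⟨x_i, by simp only [hq i hin, x_i]⟩
    · refine J.pow_mem_of_mem ⟨x_i, ?_, rfl⟩ _ (Nat.succ_pos _)
      exact (TwoSidedIdeal.mem_comap _).2 (TwoSidedIdeal.subset_span ⟨i, hin, rfl⟩)
  obtain ⟨f', hf', heq⟩ := hle hf
  rw [← Subtype.ext heq]
  exact (TwoSidedIdeal.mem_comap _).1 hf'

section Eval

variable {p : ℕ} [Fact p.Prime] {B : Type*} [CommRing B] [Algebra (ZMod p) B]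

theorem aeval_pow_char_eq_zero {σ : Type*} {a : σ → B} (ha : ∀ i, a i ^ p = 0)
    {P : MvPolynomial σ (ZMod p)} (hP : constantCoeff P = 0) : aeval a P ^ p = 0 := by
  have hap : a ^ p = fun _ => 0 := funext ha
  rw [← map_pow, ← expand_zmod, aeval_expand, hap, aeval_zero', hP, map_zero]

variable {a : ℕ → B} (ha : ∀ i, a i ^ p = 0)

include ha in
theorem aeval_eq_zero_of_mem_powerIdeal {f : PolyNoConst p} (hf : f ∈ powerIdeal p) :
    aeval a (polyInclusion p f) = 0 := by
  have hle : powerIdeal p ≤ TwoSidedIdeal.ker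
      ((aeval a : _ →ₐ[ZMod p] B).toRingHom.toNonUnitalRingHom.comp (polyInclusion p)) := by
    refine TwoSidedIdeal.span_le.2 ?_
    rintro f ⟨g, hfg⟩
    refine (TwoSidedIdeal.mem_ker _).2 ?_
    change aeval a (f : MvPolynomial ℕ (ZMod p)) = 0
    rw [hfg, map_pow, aeval_pow_char_eq_zero ha g.2]
  exact (TwoSidedIdeal.mem_ker _).1 (hle hf)

variable (a) in
/-- The homomorphism from the free nil ring to `B` sending each generator `x i` to `a i`. -/
def eval : FreeNil p →ₙ+* B :=
  liftOfSurjective (quotientHom (powerIdeal p)) (quotientHom_surjective _)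
    ((aeval a : _ →ₐ[ZMod p] B).toRingHom.toNonUnitalRingHom.comp (polyInclusion p))
    fun _ hf => aeval_eq_zero_of_mem_powerIdeal ha (quotientHom_eq_zero_iff.1 hf)

theorem eval_quotientHom (f : PolyNoConst p) :
    eval a ha (quotientHom (powerIdeal p) f) = aeval a (polyInclusion p f) :=
  liftOfSurjective_apply _ _ _ _ f

theorem eval_x (i : ℕ) : eval a ha (x p i) = a i :=
  (eval_quotientHom ha _).trans (aeval_X a i)

variable {n : ℕ} {U : Ideal B}

theorem eval_pow_char (g : FreeNil p) : eval a ha g ^ p = 0 := by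
  obtain ⟨f, rfl⟩ := quotientHom_surjective _ g
  rw [eval_quotientHom]
  exact aeval_pow_char_eq_zero ha f.2

theorem eval_mem_of_mem_tailIdeal (haU : ∀ i, n ≤ i → a i ∈ U) {g : FreeNil p}
    (hg : g ∈ tailIdeal p n) : eval a ha g ∈ U := by
  let π : FreeNil p →ₙ+* B ⧸ U := (Ideal.Quotient.mk U : B →ₙ+* B ⧸ U).comp (eval a ha)
  have hπ {g : FreeNil p} : g ∈ TwoSidedIdeal.ker π ↔ eval a ha g ∈ U :=
    (TwoSidedIdeal.mem_ker π).trans Ideal.Quotient.eq_zero_iff_mem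
  have hle : tailIdeal p n ≤ TwoSidedIdeal.ker π := by
    refine TwoSidedIdeal.span_le.2 ?_
    rintro _ ⟨i, hi, rfl⟩
    exact hπ.2 ((eval_x ha i).symm ▸ haU i hi)
  exact hπ.1 (hle hg)

theorem mem_tailIdeal_of_eval_mem (haU : ∀ i, n ≤ i → a i ∈ U)
    (hprod : ∏ i ∈ Finset.range n, a i ^ (p - 1) ∉ U) {g : FreeNil p} (hg : eval a ha g ∈ U) :
    g ∈ tailIdeal p n := by
  classical
  obtain ⟨f, rfl⟩ := quotientHom_surjective _ g
  let q : ℕ →₀ ℕ := Finsupp.indicator (Finset.range n) fun _ _ => p - 1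
  have hq_lt {i : ℕ} (hi : i < n) : q i = p - 1 :=
    Finsupp.indicator_of_mem (Finset.mem_range.2 hi) _
  have hq_succ {i : ℕ} (hi : i < n) : q i + 1 = p := by
    rw [hq_lt hi, Nat.sub_add_cancel (Fact.out : p.Prime).one_le]
  let b : ℕ → B ⧸ U := fun i => Ideal.Quotient.mk U (a i)
  have hb : ∀ i, b i ^ (q i + 1) = 0 := by
    intro i
    rcases lt_or_ge i n with hi | hi
    · rw [hq_succ hi, ← map_pow, ha, map_zero]
    · exact pow_eq_zero_of_le (Nat.succ_pos _) (by
        rw [pow_one]; exact Ideal.Quotient.eq_zero_iff_mem.2 (haU i hi))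
  have hbq : (q.prod fun i e => b i ^ e) ≠ 0 := by
    have hprod_eq : (q.prod fun i e => b i ^ e) =
        Ideal.Quotient.mk U (∏ i ∈ Finset.range n, a i ^ (p - 1)) := by
      simp only [q, b, map_prod, map_pow]
      exact Finsupp.prod_indicator_index _ fun _ _ => pow_zero _
    rwa [hprod_eq, ne_eq, Ideal.Quotient.eq_zero_iff_mem]
  refine mem_tailIdeal_of_mem_span (fun i => hq_succ) (ker_aeval_le_span hb hbq ?_)
  change aeval (fun i => Ideal.Quotient.mkₐ (ZMod p) U (a i)) (polyInclusion p f) = 0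
  rw [← comp_aeval_apply, ← eval_quotientHom ha]
  exact Ideal.Quotient.eq_zero_iff_mem.2 hg

theorem eval_mem_iff (haU : ∀ i, n ≤ i → a i ∈ U)
    (hprod : ∏ i ∈ Finset.range n, a i ^ (p - 1) ∉ U) {g : FreeNil p} :
    eval a ha g ∈ U ↔ g ∈ tailIdeal p n :=
  ⟨mem_tailIdeal_of_eval_mem ha haU hprod, eval_mem_of_mem_tailIdeal ha haU⟩

end Eval

end FreeNil

/-! ### Embedding the inverse limit into a compact ring -/

section Limit

open Topology Filter

theorem isClosed_freeProfiniteNil (p : ℕ) :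
    IsClosed (FreeProfiniteNil p : Set (∀ n, FreeNilQuot p n)) := by
  have hset : (FreeProfiniteNil p : Set (∀ n, FreeNilQuot p n)) =
      ⋂ (m) (n) (h : m ≤ n), {f | FreeNilQuot.transition p h (f n) = f m} := by
    ext f
    simp only [Set.mem_iInter]
    rfl
  rw [hset]
  exact isClosed_iInter fun m => isClosed_iInter fun n => isClosed_iInter fun h =>
    isClosed_eq (continuous_of_discreteTopology.comp (continuous_apply n)) (continuous_apply m)

/-- The canonical map `F_0 → F_0 / I_n`. -/
def FreeNilQuot.mk (p n : ℕ) : FreeNil p →ₙ+* FreeNilQuot p n := quotientHom (tailIdeal p n)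

theorem FreeNilQuot.mk_surjective (p n : ℕ) : Function.Surjective (mk p n) :=
  quotientHom_surjective _

theorem FreeNilQuot.mk_eq_iff {p n : ℕ} {g h : FreeNil p} :
    mk p n g = mk p n h ↔ g - h ∈ tailIdeal p n :=
  quotientHom_eq_iff

variable {A : Type*} [CommRing A] [TopologicalSpace A] [IsTopologicalRing A] [CompactSpace A]
  {V : ℕ → Ideal A} (hV : (𝓝 (0 : A)).HasAntitoneBasis fun n => (V n : Set A))

include hV

theorem exists_forall_sub_mem {c : ℕ → A} (hc : ∀ m n, m ≤ n → c n - c m ∈ V m) :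
    ∃ a, ∀ n, a - c n ∈ V n := by
  obtain ⟨a, ha⟩ := exists_clusterPt_of_compactSpace (map c atTop)
  refine ⟨a, fun m => ?_⟩
  have hclosed : IsClosed {x | x - c m ∈ V m} :=
    ((V m).toAddSubgroup.isClosed_of_isOpen (isOpen_of_hasAntitoneBasis hV m)).preimage
      (continuous_id.sub continuous_const)
  exact hclosed.mem_of_mapClusterPt ha ((eventually_ge_atTop m).mono (hc m))

variable {p : ℕ} {ψ : FreeNil p →ₙ+* A} (hψ : ∀ n g, ψ g ∈ V n ↔ g ∈ tailIdeal p n)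

include hψ

theorem compactSpace_freeProfiniteNil : CompactSpace (FreeProfiniteNil p) := by
  have (n : ℕ) : Finite (FreeNilQuot p n) := by
    have : Finite (A ⧸ V n) :=
      AddSubgroup.quotient_finite_of_isOpen (V n).toAddSubgroup (isOpen_of_hasAntitoneBasis hV n)
    let ι := liftOfSurjective (FreeNilQuot.mk p n) (FreeNilQuot.mk_surjective p n)
      ((Ideal.Quotient.mk (V n) : A →ₙ+* A ⧸ V n).comp ψ) fun g hg =>
        Ideal.Quotient.eq_zero_iff_mem.2 ((hψ n g).2 (quotientHom_eq_zero_iff.1 hg))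
    refine Finite.of_injective ι ((injective_iff_map_eq_zero ι).2 ?_)
    refine (FreeNilQuot.mk_surjective p n).forall.2 fun g hg => quotientHom_eq_zero_iff.2 ?_
    exact (hψ n g).1 (Ideal.Quotient.eq_zero_iff_mem.1
      ((liftOfSurjective_apply _ _ _ _ g).symm.trans hg))
  exact isCompact_iff_compactSpace.1 (isClosed_freeProfiniteNil p).isCompact

theorem exists_forall_sub_mem_of_mk_eq (f : FreeProfiniteNil p) :
    ∃ a, ∀ n g, FreeNilQuot.mk p n g = f.1 n → a - ψ g ∈ V n := by
  choose g hg using fun n => FreeNilQuot.mk_surjective p n (f.1 n)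
  have hc : ∀ m n, m ≤ n → ψ (g n) - ψ (g m) ∈ V m := by
    intro m n hmn
    rw [← map_sub, hψ, ← FreeNilQuot.mk_eq_iff, hg m, ← f.2 m n hmn, ← hg n]
    rfl
  obtain ⟨a, ha⟩ := exists_forall_sub_mem hV hc
  refine ⟨a, fun n h hh => ?_⟩
  have hgh : ψ (g n) - ψ h ∈ V n := by
    rw [← map_sub, hψ, ← FreeNilQuot.mk_eq_iff, hg, hh]
  simpa only [sub_add_sub_cancel] using (V n).add_mem (ha n) hgh

variable [T2Space A]

theorem exists_hom_forall_sub_mem :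
    ∃ Φ : FreeProfiniteNil p →ₙ+* A,
      ∀ f n g, FreeNilQuot.mk p n g = f.1 n → Φ f - ψ g ∈ V n := by
  choose Φ hΦ using exists_forall_sub_mem_of_mk_eq hV hψ
  have eq_of_mem {a b : A} (h : ∀ n, a - b ∈ V n) : a = b := by
    by_contra hab
    obtain ⟨n, hn⟩ := exists_notMem_of_ne_zero hV (sub_ne_zero.2 hab)
    exact hn (h n)
  have map_add (f f') : Φ (f + f') = Φ f + Φ f' := eq_of_mem fun n => by
    obtain ⟨g, hg⟩ := FreeNilQuot.mk_surjective p n (f.1 n)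
    obtain ⟨g', hg'⟩ := FreeNilQuot.mk_surjective p n (f'.1 n)
    have hsum : FreeNilQuot.mk p n (g + g') = (f + f').1 n := by rw [_root_.map_add, hg, hg']; rfl
    have hmem := (V n).sub_mem (hΦ (f + f') n _ hsum) ((V n).add_mem (hΦ f n g hg) (hΦ f' n g' hg'))
    rw [_root_.map_add] at hmem
    convert hmem using 1
    ring
  have map_mul (f f') : Φ (f * f') = Φ f * Φ f' := eq_of_mem fun n => by
    obtain ⟨g, hg⟩ := FreeNilQuot.mk_surjective p n (f.1 n)
    obtain ⟨g', hg'⟩ := FreeNilQuot.mk_surjective p n (f'.1 n)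
    have hprod : FreeNilQuot.mk p n (g * g') = (f * f').1 n := by rw [_root_.map_mul, hg, hg']; rfl
    have hmem := (V n).sub_mem (hΦ (f * f') n _ hprod)
      ((V n).add_mem ((V n).mul_mem_left (Φ f) (hΦ f' n g' hg'))
        ((V n).mul_mem_right (ψ g') (hΦ f n g hg)))
    rw [_root_.map_mul] at hmem
    convert hmem using 1
    ring
  have map_zero : Φ 0 = 0 := by simpa only [add_zero, left_eq_add] using map_add 0 0
  exact ⟨{ toFun := Φ, map_zero' := map_zero, map_add' := map_add, map_mul' := map_mul }, hΦ⟩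

theorem exists_isClosedEmbedding_of_freeNil :
    ∃ Φ : FreeProfiniteNil p →ₙ+* A, IsClosedEmbedding Φ ∧ ∀ f, Φ f ∈ closure (Set.range ψ) := by
  have := compactSpace_freeProfiniteNil hV hψ
  obtain ⟨Φ, hΦ⟩ := exists_hom_forall_sub_mem hV hψ
  have hΦ_mem {f : FreeProfiniteNil p} {n : ℕ} : Φ f ∈ V n ↔ f.1 n = 0 := by
    obtain ⟨g, hg⟩ := FreeNilQuot.mk_surjective p n (f.1 n)
    have hg_mem : ψ g ∈ V n ↔ f.1 n = 0 := by rw [hψ, ← hg]; exact quotientHom_eq_zero_iff.symm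
    rw [← hg_mem]
    exact ⟨fun h => ((V n).sub_mem_iff_right h).1 (hΦ f n g hg),
      fun h => ((V n).sub_mem_iff_left h).1 (hΦ f n g hg)⟩
  have hcont : Continuous Φ := by
    refine continuous_of_continuousAt_zero Φ ?_
    rw [ContinuousAt, map_zero, hV.tendsto_right_iff]
    intro n _
    have hcoord : Continuous fun f : FreeProfiniteNil p => f.1 n :=
      (continuous_apply n).comp continuous_subtype_val
    filter_upwards [((isOpen_discrete {0}).preimage hcoord).mem_nhds rfl] with f hf
    exact hΦ_mem.2 hf
  refine ⟨Φ, hcont.isClosedEmbedding ((injective_iff_map_eq_zero Φ).2 fun f hf => ?_), fun f => ?_⟩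
  · exact Subtype.ext (funext fun n => hΦ_mem.1 (hf ▸ (V n).zero_mem))
  · choose g hg using fun n => FreeNilQuot.mk_surjective p n (f.1 n)
    have hlim : Tendsto (fun n => Φ f - (Φ f - ψ (g n))) atTop (𝓝 (Φ f - 0)) :=
      tendsto_const_nhds.sub (hV.tendsto fun n => hΦ f n (g n) (hg n))
    simp only [sub_sub_cancel, sub_zero] at hlim
    exact mem_closure_of_tendsto hlim (Eventually.of_forall fun n => Set.mem_range_self (g n))

end Limit

/-! ### Compact rings of prime characteristic -/

section CharP

open Topology

variable {A : Type*} [CommRing A] (p : ℕ) [Fact p.Prime] [CharP A p]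

theorem ker_iterateFrobenius_pow_le {j m : ℕ}
    (hm : RingHom.ker (frobenius (iterateFrobenius A p j).range p) ^ m = ⊥) :
    RingHom.ker (iterateFrobenius A p (j + 1)) ^ m ≤ RingHom.ker (iterateFrobenius A p j) := by
  set f := iterateFrobenius A p j
  have hle : RingHom.ker (iterateFrobenius A p (j + 1)) ≤
      (RingHom.ker (frobenius f.range p)).comap f.rangeRestrict := by
    intro x hx
    refine Subtype.ext ?_
    change (x ^ p ^ j) ^ p = 0
    rw [← pow_mul, ← pow_succ]
    exact hx
  calc _ ≤ _ := Ideal.pow_right_mono hle m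
    _ ≤ _ := Ideal.le_comap_pow f.rangeRestrict m
    _ = RingHom.ker f := by rw [hm, ← RingHom.ker_eq_comap_bot, RingHom.ker_rangeRestrict]

theorem exists_ker_frobenius_range_not_isNilpotent
    {k : ℕ} (hk : ¬ IsNilpotent (RingHom.ker (iterateFrobenius A p k))) :
    ∃ j, ¬ IsNilpotent (RingHom.ker (frobenius (iterateFrobenius A p j).range p)) := by
  by_contra! hnil
  refine hk ?_
  clear hk
  induction k with
  | zero =>
    refine ⟨1, le_bot_iff.1 fun x hx => ?_⟩
    simpa [iterateFrobenius_zero] using hx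
  | succ j ih =>
    obtain ⟨l, hl⟩ := ih
    obtain ⟨m, hm⟩ := hnil j
    refine ⟨m * l, le_bot_iff.1 ?_⟩
    rw [pow_mul]
    exact (Ideal.pow_right_mono (ker_iterateFrobenius_pow_le p hm) l).trans hl.le

variable [TopologicalSpace A] [IsTopologicalRing A] [CompactSpace A] [T2Space A]

theorem exists_nilradical_le_ker_iterateFrobenius (hN : IsClosed (nilradical A : Set A)) :
    ∃ k, nilradical A ≤ RingHom.ker (iterateFrobenius A p k) := by
  have : CompactSpace (nilradical A) := isCompact_iff_compactSpace.1 hN.isCompact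
  let H (n : ℕ) : AddSubgroup (nilradical A) :=
    ((iterateFrobenius A p n).toAddMonoidHom.comp (nilradical A).toAddSubgroup.subtype).ker
  have hH {n : ℕ} {x : nilradical A} : x ∈ H n ↔ (x : A) ^ p ^ n = 0 := Iff.rfl
  obtain ⟨k, hk⟩ : ∃ k, H k = ⊤ := by
    refine exists_eq_top_of_monotone_of_isClosed (fun m n hmn x hx => ?_) (fun n => ?_) fun x => ?_
    · exact hH.2 (pow_eq_zero_of_le (Nat.pow_le_pow_right (Fact.out : p.Prime).pos hmn) (hH.1 hx))
    · exact isClosed_eq (continuous_subtype_val.pow _) continuous_const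
    · obtain ⟨m, hm⟩ := mem_nilradical.1 x.2
      exact ⟨m, hH.2 (pow_eq_zero_of_le (Nat.lt_pow_self (Fact.out : p.Prime).one_lt).le hm)⟩
  exact ⟨k, fun x hx => RingHom.mem_ker.2
    (hH.1 (hk ▸ AddSubgroup.mem_top (⟨x, hx⟩ : nilradical A)))⟩

variable {V : ℕ → Ideal A} (hV : (𝓝 (0 : A)).HasAntitoneBasis fun n => (V n : Set A))

include hV

theorem exists_isClosedEmbedding_of_forall_pow_eq_zero {K : Ideal A} (hK : IsClosed (K : Set A))
    (hKp : ∀ x ∈ K, x ^ p = 0) (hK' : ¬ IsNilpotent K) :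
    ∃ Φ : FreeProfiniteNil p →ₙ+* A, IsClosedEmbedding Φ ∧ ∀ f, Φ f ^ p = 0 := by
  let := ZMod.algebra A p
  obtain ⟨a, k, hk, ha, hprod⟩ := exists_prod_pow_notMem hV p hK (fun x hx => ⟨p, hKp x hx⟩) hK'
  have hVk := hV.comp_strictMono hk
  have haV (n i : ℕ) (hni : n ≤ i) : a i ∈ V (k n) := hVk.antitone hni (ha i).2
  have hap (i : ℕ) : a i ^ p = 0 := hKp _ (ha i).1
  obtain ⟨Φ, hΦ, hmem⟩ := exists_isClosedEmbedding_of_freeNil hVk fun n g =>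
    FreeNil.eval_mem_iff hap (haV n) (hprod n)
  have hclosed : IsClosed {x : A | x ^ p = 0} := isClosed_eq (continuous_pow p) continuous_const
  exact ⟨Φ, hΦ, fun f => closure_minimal
    (Set.range_subset_iff.2 (FreeNil.eval_pow_char hap)) hclosed (hmem f)⟩

theorem exists_isClosedEmbedding_of_not_isNilpotent_nilradical
    (hN : IsClosed (nilradical A : Set A)) (hN' : ¬ IsNilpotent (nilradical A)) :
    ∃ Φ : FreeProfiniteNil p →ₙ+* A, IsClosedEmbedding Φ ∧ ∀ f, Φ f ^ p = 0 := by
  obtain ⟨k, hk⟩ := exists_nilradical_le_ker_iterateFrobenius p hN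
  have hker : ¬ IsNilpotent (RingHom.ker (iterateFrobenius A p k)) := by
    rintro ⟨m, hm⟩
    exact hN' ⟨m, le_bot_iff.1 ((Ideal.pow_right_mono hk m).trans hm.le)⟩
  obtain ⟨j, hj⟩ := exists_ker_frobenius_range_not_isNilpotent p hker
  set B := (iterateFrobenius A p j).range
  have hB : IsClosed (B : Set A) := (isCompact_range (continuous_pow (p ^ j))).isClosed
  have : CompactSpace B := isCompact_iff_compactSpace.1 hB.isCompact
  have hVB : (𝓝 (0 : B)).HasAntitoneBasis fun n => ((V n).comap B.subtype : Set B) := by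
    rw [nhds_subtype]
    exact hV.comap _
  have hKclosed : IsClosed (RingHom.ker (frobenius B p) : Set B) :=
    isClosed_eq (continuous_pow p) continuous_const
  obtain ⟨Φ, hΦ, hΦp⟩ :=
    exists_isClosedEmbedding_of_forall_pow_eq_zero p hVB hKclosed (fun _ hx => hx) hj
  exact ⟨(B.subtype : B →ₙ+* A).comp Φ, hB.isClosedEmbedding_subtypeVal.comp hΦ,
    fun f => congrArg Subtype.val (hΦp f)⟩

end CharP

/-! ### Adjoining an identity to a topological ring -/

section TopologicalUnitization

open Topology

variable {k R : Type*} [TopologicalSpace k] [TopologicalSpace R]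

/-- The topology of `k × R` on the unitization. -/
@[reducible] def unitizationTopology (k R : Type*) [TopologicalSpace k] [TopologicalSpace R] :
    TopologicalSpace (Unitization k R) :=
  TopologicalSpace.induced Unitization.equiv inferInstance

attribute [local instance] unitizationTopology

/-- The unitization as the topological space `k × R`. -/
def unitizationHomeomorph (k R : Type*) [TopologicalSpace k] [TopologicalSpace R] :
    Unitization k R ≃ₜ k × R :=
  Unitization.equiv.toHomeomorphOfIsInducing ⟨rfl⟩

theorem continuous_fst_unitization : Continuous fun a : Unitization k R => a.fst :=
  continuous_fst.comp (unitizationHomeomorph k R).continuous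

theorem continuous_snd_unitization : Continuous fun a : Unitization k R => a.snd :=
  continuous_snd.comp (unitizationHomeomorph k R).continuous

theorem continuous_unitization_iff {X : Type*} [TopologicalSpace X] {f : X → Unitization k R} :
    Continuous f ↔ Continuous (fun x => (f x).fst) ∧ Continuous fun x => (f x).snd :=
  (unitizationHomeomorph k R).isInducing.continuous_iff.trans continuous_prodMk

instance [CompactSpace k] [CompactSpace R] : CompactSpace (Unitization k R) :=
  (unitizationHomeomorph k R).symm.compactSpace

instance [T2Space k] [T2Space R] : T2Space (Unitization k R) :=
  (unitizationHomeomorph k R).symm.t2Space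

theorem isOpenEmbedding_inr [Zero k] [DiscreteTopology k] :
    IsOpenEmbedding (Unitization.inr : R → Unitization k R) := by
  have hcont : Continuous (Unitization.inr : R → Unitization k R) :=
    continuous_unitization_iff.2 ⟨continuous_const, continuous_id⟩
  have hinv : Function.LeftInverse (fun a => a.snd) (Unitization.inr : R → Unitization k R) :=
    Unitization.snd_inr k
  refine ⟨hinv.isEmbedding continuous_snd_unitization hcont, ?_⟩
  have hrange : Set.range (Unitization.inr : R → Unitization k R) = (fun a => a.fst) ⁻¹' {0} := by
    ext a
    exact ⟨by rintro ⟨x, rfl⟩; rfl, fun ha => ⟨a.snd, Unitization.ext (Eq.symm ha) rfl⟩⟩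
  rw [hrange]
  exact (isOpen_discrete _).preimage continuous_fst_unitization

instance [CommRing k] [NonUnitalCommRing R] [Module k R] [IsScalarTower k R R]
    [SMulCommClass k R R] [IsTopologicalRing k] [IsTopologicalRing R] [ContinuousSMul k R] :
    IsTopologicalRing (Unitization k R) :=
  have hfst := continuous_fst_unitization (k := k) (R := R)
  have hsnd := continuous_snd_unitization (k := k) (R := R)
  have hfst₁ := hfst.comp (continuous_fst (Y := Unitization k R))
  have hfst₂ := hfst.comp (continuous_snd (X := Unitization k R))
  have hsnd₁ := hsnd.comp (continuous_fst (Y := Unitization k R))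
  have hsnd₂ := hsnd.comp (continuous_snd (X := Unitization k R))
  { continuous_add := continuous_unitization_iff.2 ⟨hfst₁.add hfst₂, hsnd₁.add hsnd₂⟩
    continuous_mul := continuous_unitization_iff.2 ⟨hfst₁.mul hfst₂,
      ((hfst₁.smul hsnd₂).add (hfst₂.smul hsnd₁)).add (hsnd₁.mul hsnd₂)⟩
    continuous_neg := continuous_unitization_iff.2 ⟨hfst.neg, hsnd.neg⟩ }

/-! ### Embedding `F` in a small profinite ring of characteristic `p` -/

theorem exists_isClosed_nonUnitalSubring_ringEquiv {F R : Type*} [NonUnitalNonAssocRing F]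
    [NonUnitalNonAssocRing R] [TopologicalSpace F] [TopologicalSpace R]
    {φ : F →ₙ+* R} (hφ : IsClosedEmbedding φ) :
    ∃ S : NonUnitalSubring R, IsClosed (S : Set R) ∧
      ∃ e : F ≃+* S, Continuous e ∧ Continuous e.symm := by
  refine ⟨φ.range, hφ.isClosed_range, ?_⟩
  let e : F ≃+* φ.range := RingEquiv.ofBijective φ.rangeRestrict
    ⟨fun x y h => hφ.injective (congrArg Subtype.val h), φ.rangeRestrict_surjective⟩
  refine ⟨e, hφ.continuous.subtype_mk _, hφ.isInducing.continuous_iff.2 ?_⟩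
  convert continuous_subtype_val (p := (· ∈ φ.range)) using 1
  funext y
  exact congrArg Subtype.val (e.apply_symm_apply y)

section ZMod

variable {p : ℕ} {R : Type*}

theorem zmod_isScalarTower [NonUnitalNonAssocRing R] [Module (ZMod p) R] :
    IsScalarTower (ZMod p) R R where
  smul_assoc c x y := by
    obtain ⟨n, rfl⟩ := ZMod.intCast_surjective c
    simp only [Int.cast_smul_eq_zsmul, smul_eq_mul, smul_mul_assoc]

theorem zmod_smulCommClass [NonUnitalNonAssocRing R] [Module (ZMod p) R] :
    SMulCommClass (ZMod p) R R where
  smul_comm c x y := by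
    obtain ⟨n, rfl⟩ := ZMod.intCast_surjective c
    simp only [Int.cast_smul_eq_zsmul, smul_eq_mul, mul_smul_comm]

theorem zmod_continuousSMul [AddCommGroup R] [Module (ZMod p) R] [TopologicalSpace R]
    [IsTopologicalAddGroup R] : ContinuousSMul (ZMod p) R where
  continuous_smul := continuous_prod_of_discrete_left.2 fun c => by
    obtain ⟨n, rfl⟩ := ZMod.intCast_surjective c
    simp only [Int.cast_smul_eq_zsmul]
    exact continuous_zsmul n

variable [NonUnitalCommRing R] [Module (ZMod p) R] [IsScalarTower (ZMod p) R R]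
  [SMulCommClass (ZMod p) R R]

theorem charP_unitization : CharP (Unitization (ZMod p) R) p :=
  charP_of_injective_algebraMap (R := ZMod p) (Unitization.inl_injective) p

variable (p R) in
/-- The inclusion of a ring of characteristic `p` into the ring with an identity adjoined. -/
def unitizationInclusion : R →ₙ+* Unitization (ZMod p) R :=
  Unitization.inrNonUnitalAlgHom (ZMod p) R

theorem exists_eq_intCast_add_unitizationInclusion (a : Unitization (ZMod p) R) :
    ∃ (n : ℤ) (r : R), a = n + unitizationInclusion p R r := by
  obtain ⟨n, hn⟩ := ZMod.intCast_surjective a.fst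
  refine ⟨n, a.snd, (Unitization.inl_fst_add_inr_snd_eq a).symm.trans ?_⟩
  rw [← hn, ← map_intCast (Unitization.inlRingHom (ZMod p) R) n]
  rfl

theorem SmallProfiniteStructure.exists_hasAntitoneBasis_ideal [TopologicalSpace R]
    [IsTopologicalRing R] [CompactSpace R] [T2Space R] (s : SmallProfiniteStructure R) :
    ∃ V : ℕ → Ideal (Unitization (ZMod p) R),
      (𝓝 (0 : Unitization (ZMod p) R)).HasAntitoneBasis fun n => (V n : Set _) := by
  have : (𝓝 (0 : R)).IsCountablyGenerated :=
    Filter.HasCountableBasis.isCountablyGenerated ⟨s.basis_hasBasis, s.basis_countable⟩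
  obtain ⟨I, -, hI⟩ := s.basis_hasBasis.exists_antitone_subbasis
  refine ⟨fun n => imageIdeal _ exists_eq_intCast_add_unitizationInclusion (I n), ?_⟩
  simp only [coe_imageIdeal]
  have hmap := isOpenEmbedding_inr (k := ZMod p).map_nhds_eq (0 : R)
  rw [← Unitization.inr_zero, ← hmap]
  exact hI.map _

theorem SmallProfiniteStructure.exists_isClosedEmbedding_freeProfiniteNil {R : Type*}
    [NonUnitalCommRing R] [TopologicalSpace R] [IsTopologicalRing R] [CompactSpace R] [T2Space R]
    [Fact p.Prime] [Module (ZMod p) R] (s : SmallProfiniteStructure R)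
    (hs : ¬ IsNilpotentSet (jacobsonRadical R)) :
    ∃ φ : FreeProfiniteNil p →ₙ+* R, IsClosedEmbedding φ := by
  have : IsScalarTower (ZMod p) R R := zmod_isScalarTower
  have : SMulCommClass (ZMod p) R R := zmod_smulCommClass
  have : ContinuousSMul (ZMod p) R := zmod_continuousSMul
  have : CharP (Unitization (ZMod p) R) p := charP_unitization
  have hinr := isOpenEmbedding_inr (k := ZMod p) (R := R)
  have hN : IsClosed (nilradical (Unitization (ZMod p) R) : Set (Unitization (ZMod p) R)) := by
    rw [s.coe_nilradical_unitization]
    exact (isClosed_jacobsonRadical.isCompact.image hinr.continuous).isClosed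
  obtain ⟨V, hV⟩ := s.exists_hasAntitoneBasis_ideal (p := p)
  obtain ⟨Φ, hΦ, hΦp⟩ := exists_isClosedEmbedding_of_not_isNilpotent_nilradical p hV hN
    (s.isNilpotentSet_jacobsonRadical_iff.not.1 hs)
  choose φ hφ using fun f => exists_inr_of_isNilpotent ⟨p, hΦp f⟩
  have hinj := Unitization.inr_injective (R := ZMod p) (A := R)
  refine ⟨{ toFun := φ
            map_zero' := hinj ?_
            map_mul' := fun f g => hinj ?_
            map_add' := fun f g => hinj ?_ }, ?_⟩
  · rw [hφ, map_mul, Unitization.inr_mul, hφ, hφ]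
  · rw [hφ, map_zero, Unitization.inr_zero]
  · rw [hφ, map_add, Unitization.inr_add, hφ, hφ]
  · have hcomp : IsClosedEmbedding fun f => (φ f : Unitization (ZMod p) R) := by
      simpa only [hφ] using hΦ
    exact .of_comp hinr.isEmbedding hcomp

end ZMod

end TopologicalUnitization

end SmallProfinite

end

theorem mainTheorem6
    (hfail : ¬ SmallProfinite.CommNilpotentRadicalConjecture.{u}) :
    ∃ (R : Type u) (_ : NonUnitalCommRing R) (_ : TopologicalSpace R) (_ : IsTopologicalRing R)
      (_ : CompactSpace R) (_ : T2Space R),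
      Nonempty (SmallProfinite.SmallProfiniteStructure R) ∧
      ¬ SmallProfinite.IsNilpotentSet (SmallProfinite.jacobsonRadical R) ∧
      ∃ p : ℕ, p.Prime ∧
        ∃ S : NonUnitalSubring R, IsClosed (S : Set R) ∧
          ∃ e : SmallProfinite.FreeProfiniteNil p ≃+* S, Continuous e ∧ Continuous e.symm := by
  unfold SmallProfinite.CommNilpotentRadicalConjecture at hfail
  push Not at hfail
  obtain ⟨R, _, _, _, _, _, s, hs⟩ := hfail
  obtain ⟨p, hp, hQ⟩ := s.exists_prime_not_isNilpotentSet hs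
  have : Fact p.Prime := ⟨hp⟩
  have sQ := s.quotientMultiples p
  let : Module (ZMod p) (SmallProfinite.multiplesIdeal R p).ringCon.Quotient :=
    AddCommGroup.zmodModule SmallProfinite.nsmul_quotient_multiplesIdeal
  obtain ⟨φ, hφ⟩ := sQ.exists_isClosedEmbedding_freeProfiniteNil (p := p) hQ
  exact ⟨_, inferInstance, inferInstance, inferInstance, inferInstance, inferInstance, ⟨sQ⟩, hQ,
    p, hp, SmallProfinite.exists_isClosed_nonUnitalSubring_ringEquiv hφ⟩
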